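/- Let $I=[0,1]$. For a continuous map $F:X\to X$ on a compact metric space and $x\in X$, let the special $\alpha$-limit set $s\alpha(x)$ be the set of all accumulation points of backward orbits of $x$, i.e. the union, over all sequences $(x_n)_{n\ge 0}$ in $X$ with $x_0=x$ and $F(x_{n+1})=x_n$ for all $n$, of the set of limits of convergent subsequences of $(x_n)$. Call a subset $S$ of a Polish space $Y$ $\boldsymbol\Sigma^1_1$-complete if $S$ is analytic and for every analytic subset $B$ of a zero-dimensional Polish space $Z$ (one with a basis of clopen sets) there is a continuous map $r:Z\to Y$ with $r^{-1}(S)=B$. **Theorem.** There are a continuous surjective map $F:I^2\to I^2$ and a point $x_0\in I^2$ such that $s\alpha(x_0)\subset I^2$ is $\boldsymbol\Sigma^1_1$-complete, and not Borel. Moreover, $F$ can be taken to be a piecewise monotone triangular map (skew product), i.e. $F(x,y)=(f(x),g_x(y))$ where, for some subdivision $0=a_0<a_1<\dots<a_n=1$, the base map $f:I\to I$ is strictly increasing or strictly decreasing on each $[a_i,a_{i+1}]$, and every fibre map $g_x:I\to I$ is strictly increasing. -/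

import Mathlib

/-- The closed unit square `[0,1]²` (the topology of the plane restricted to the square is the
product topology). -/
abbrev UnitSquare : Type := unitInterval × unitInterval

/-- `u` is a backward orbit of the point `x` under `f`: `u 0 = x` and `f (u (n+1)) = u n`. -/
def IsBackwardOrbit {X : Type*} (f : X → X) (x : X) (u : ℕ → X) : Prop :=
  u 0 = x ∧ ∀ n, f (u (n + 1)) = u n

/-- The special `α`-limit set of `x` under `f`: the union, over all backward orbits of `x`, of the
set of accumulation points of the orbit (points of which every neighbourhood contains `u n` for
infinitely many `n`). -/
def specialAlphaLimit {X : Type*} [TopologicalSpace X] (f : X → X) (x : X) : Set X :=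
  {y | ∃ u : ℕ → X, IsBackwardOrbit f x u ∧ MapClusterPt y Filter.atTop u}

/-- A set is `Σ¹₁`-complete if it is analytic and every analytic subset of a zero-dimensional
Polish space (one with a basis of clopen sets) is its preimage under some continuous map. Every
Polish space has at most continuum many points, so the spaces in `Type` represent all of them. -/
def IsSigmaOneOneComplete {Y : Type*} [TopologicalSpace Y] (S : Set Y) : Prop :=
  MeasureTheory.AnalyticSet S ∧
    ∀ (X : Type) [TopologicalSpace X] [PolishSpace X],
      TopologicalSpace.IsTopologicalBasis {U : Set X | IsClopen U} →
      ∀ B : Set X, MeasureTheory.AnalyticSet B → ∃ r : X → Y, Continuous r ∧ r ⁻¹' S = B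

/-- A self-map of `[0,1]` is piecewise (strictly) monotone if there is a subdivision
`0 = a 0 < ⋯ < a n = 1` such that the map is strictly increasing or strictly decreasing on each
of the closed intervals `[a i, a (i+1)]`. -/
def IsPiecewiseMonotone (f : unitInterval → unitInterval) : Prop :=
  ∃ (n : ℕ) (a : Fin (n + 1) → unitInterval),
    StrictMono a ∧ a 0 = 0 ∧ a (Fin.last n) = 1 ∧
      ∀ i : Fin n, StrictMonoOn f (Set.Icc (a i.castSucc) (a i.succ)) ∨
        StrictAntiOn f (Set.Icc (a i.castSucc) (a i.succ))

/-- A self-map `F` of the square is a piecewise monotone triangular map (skew product) if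
`F (x, y) = (f x, g x y)` with piecewise monotone base map `f` and with all fibre maps `g x`
strictly increasing; thus the square is cut into finitely many vertical strips on each of which
`F` is strictly monotone in the base and in the fibres. -/
def IsPiecewiseMonotoneTriangular (F : UnitSquare → UnitSquare) : Prop :=
  ∃ (f : unitInterval → unitInterval) (g : unitInterval → unitInterval → unitInterval),
    (∀ x y, F (x, y) = (f x, g x y)) ∧ IsPiecewiseMonotone f ∧ ∀ x, StrictMono (g x)

/-!
The base map `zigzag` has three laps over `[0, 4/5]`, so the backward orbits of the point `7/10`
are the branches `w : ℕ → Fin 3` of a ternary tree of distinct isolated points, and long runs of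
zeros in `w` bring such an orbit close to `0`. The fibre maps are time-`t` maps of a flow on the
interval, which acts on the interior by translations in a suitable coordinate. Choosing the times
on the tree therefore amounts to prescribing the heights of the lifted tree points.

A word is given a code that converges along each branch to the code of `w` and that keeps every
value attainable with arbitrarily long runs of zeros. The prescribed height is the average, over
the suffixes of the word, of a continuous bounded function `φ` of the code. Along the branch `w` it
converges to `φ` of the code of `w`, while its increments tend to `0` over the whole tree; this is
what lets the times extend continuously to the base, by Tietze. Hence the part of the special
`α`-limit set over `0` is a copy of the range of `φ`, which is an arbitrary nonempty bounded
analytic subset of the line. It is taken to be a copy of the complete set of ill-founded trees.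
-/

open Filter MeasureTheory PiNat Set Topology
open TopologicalSpace (IsTopologicalBasis)

instance polishSpace_pi_bool {ι : Type*} [Countable ι] : PolishSpace (ι → Bool) := by
  have : TopologicalSpace.IsCompletelyMetrizableSpace (ι → Bool) := inferInstance
  have : TopologicalSpace.SeparableSpace (ι → Bool) := inferInstance
  infer_instance

lemma isLocallyConstant_res {α : Type*} [TopologicalSpace α] [DiscreteTopology α] (n : ℕ) :
    IsLocallyConstant fun x : ℕ → α => res x n := by
  induction n with
  | zero => exact IsLocallyConstant.const []
  | succ n ih =>
    exact ((IsLocallyConstant.iff_continuous _).2 (continuous_apply n)).comp₂ ih List.cons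

lemma tendsto_of_res_eq {α : Type*} [TopologicalSpace α] {u : ℕ → ℕ → α} {x : ℕ → α}
    (h : ∀ k, res (u k) k = res x k) : Tendsto u atTop (𝓝 x) := by
  refine tendsto_pi_nhds.2 fun i => tendsto_const_nhds.congr' ?_
  filter_upwards [eventually_gt_atTop i] with k hk
  exact (res_eq_res.1 (h k) hk).symm

lemma continuous_apply_of_isLocallyConstant {X ι E : Type*} [TopologicalSpace X]
    [TopologicalSpace E] {f : X → ι → E} {g : X → ι} (hf : Continuous f)
    (hg : IsLocallyConstant g) : Continuous fun x => f x (g x) := by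
  refine continuous_iff_continuousAt.2 fun x => ?_
  refine ((continuous_apply (g x)).comp hf).continuousAt.congr ?_
  filter_upwards [hg.eventually_eq x] with y hy
  rw [Function.comp_apply, hy]

lemma analyticSet_setOf_exists_forall {X : Type*} [TopologicalSpace X] [PolishSpace X]
    {P : ℕ → X → (ℕ → ℕ) → Prop} (hP : ∀ k, IsClosed {p : X × (ℕ → ℕ) | P k p.1 p.2}) :
    AnalyticSet {x | ∃ b, ∀ k, P k x b} := by
  have hclosed : IsClosed {p : X × (ℕ → ℕ) | ∀ k, P k p.1 p.2} := by
    rw [ofPred_forall]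
    exact isClosed_iInter hP
  convert hclosed.analyticSet.image_of_continuous continuous_fst
  ext x
  simp

/-- The projection `p[T]` of a set `T` of pairs of words: the sequences `a` for which some
sequence `b` has all the pairs of initial segments of `a` and `b` in `T`. -/
def treeProjection {α β : Type*} (T : Set (List α × List β)) : Set (ℕ → α) :=
  {a | ∃ b : ℕ → β, ∀ k, (res a k, res b k) ∈ T}

theorem exists_treeProjection_eq {α : Type*} [TopologicalSpace α] [T2Space α]
    {A : Set (ℕ → α)} (hA : AnalyticSet A) :
    ∃ T : Set (List α × List ℕ), treeProjection T = A := by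
  rw [AnalyticSet] at hA
  rcases hA with rfl | ⟨φ, hφ, rfl⟩
  · exact ⟨∅, by simp [treeProjection]⟩
  refine ⟨range fun p : (ℕ → ℕ) × ℕ => (res (φ p.1) p.2, res p.1 p.2), Subset.antisymm ?_ ?_⟩
  · rintro a ⟨b, hb⟩
    have happrox (k : ℕ) : ∃ c, res (φ c) k = res a k ∧ res c k = res b k := by
      obtain ⟨⟨c, m⟩, hc⟩ := hb k
      obtain ⟨h₁, h₂⟩ := Prod.ext_iff.1 hc
      obtain rfl : m = k := by simpa using congrArg List.length h₂
      exact ⟨c, h₁, h₂⟩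
    choose c hca hcb using happrox
    exact ⟨b, tendsto_nhds_unique ((hφ.tendsto b).comp (tendsto_of_res_eq hcb))
      (tendsto_of_res_eq hca)⟩
  · rintro _ ⟨b, rfl⟩
    exact ⟨b, fun k => ⟨(b, k), rfl⟩⟩

theorem exists_analyticSet_not_measurableSet :
    ∃ D : Set (ℕ → Bool), AnalyticSet D ∧ ¬ MeasurableSet[borel (ℕ → Bool)] D := by
  -- `z` codes the set of pairs of words at whose codes it is `true`, so `D` is diagonal.
  let D : Set (ℕ → Bool) := {z | ∃ b : ℕ → ℕ, ∀ k, z (Encodable.encode (res z k, res b k)) = true}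
  refine ⟨D, analyticSet_setOf_exists_forall fun k => ?_, fun hD => ?_⟩
  · refine isClosed_eq (continuous_apply_of_isLocallyConstant continuous_fst ?_) continuous_const
    exact (((isLocallyConstant_res k).comp_continuous continuous_fst).prodMk
      ((isLocallyConstant_res k).comp_continuous continuous_snd)).comp Encodable.encode
  · borelize (ℕ → Bool)
    obtain ⟨T, hT⟩ := exists_treeProjection_eq hD.compl.analyticSet
    let z : ℕ → Bool := (Encodable.encode '' T).boolIndicator
    have hz : z ∈ treeProjection T ↔ z ∈ D := by
      simp only [treeProjection, D, mem_ofPred_eq, z, ← mem_iff_boolIndicator,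
        Encodable.encode_injective.mem_set_image]
    exact not_iff_self (hT ▸ hz)

lemma exists_continuous_injective_nat_bool {X : Type*} [TopologicalSpace X] [T0Space X]
    [SecondCountableTopology X] (hX : IsTopologicalBasis {U : Set X | IsClopen U}) :
    ∃ j : X → ℕ → Bool, Continuous j ∧ Function.Injective j := by
  obtain ⟨B, hB, hBc, hBb⟩ := hX.exists_countable
  obtain ⟨V, hV⟩ := (hBc.insert ∅).exists_eq_range (insert_nonempty ∅ B)
  have hclopen (n : ℕ) : IsClopen (V n) := by
    rcases (hV ▸ mem_range_self n : V n ∈ insert ∅ B) with h | h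
    · exact h ▸ isClopen_empty
    · exact hB h
  refine ⟨fun x n => (V n).boolIndicator x,
    continuous_pi fun n => (continuous_boolIndicator_iff_isClopen _).2 (hclopen n), fun x y h => ?_⟩
  refine hBb.eq_iff.2 fun U hU => ?_
  obtain ⟨n, rfl⟩ : U ∈ range V := hV ▸ mem_insert_of_mem ∅ hU
  have hn : (V n).boolIndicator x = (V n).boolIndicator y := congrFun h n
  rw [mem_iff_boolIndicator, mem_iff_boolIndicator, hn]

lemma exists_continuous_injective_real {X : Type*} [TopologicalSpace X] [T0Space X]
    [SecondCountableTopology X] (hX : IsTopologicalBasis {U : Set X | IsClopen U}) :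
    ∃ e : X → ℝ, Continuous e ∧ Function.Injective e := by
  obtain ⟨j, hjc, hji⟩ := exists_continuous_injective_nat_bool hX
  obtain ⟨c, -, hcc, hci⟩ :=
    isClosed_univ.exists_nat_bool_injection_of_not_countable Cardinal.not_countable_real
  exact ⟨c ∘ j, hcc.comp hjc, hci.comp hji⟩

/-- The set of (characteristic functions of) sets of words over `ℕ` that contain all the initial
segments of some infinite sequence; for a tree this says that it is ill-founded. -/
def illFounded : Set (List ℕ → Bool) :=
  {T | ∃ b : ℕ → ℕ, ∀ k, T (res b k) = true}

lemma analyticSet_illFounded : AnalyticSet illFounded :=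
  analyticSet_setOf_exists_forall fun k => isClosed_eq
    (continuous_apply_of_isLocallyConstant continuous_fst
      ((isLocallyConstant_res k).comp_continuous continuous_snd)) continuous_const

lemma illFounded_nonempty : illFounded.Nonempty := ⟨fun _ => true, fun _ => 0, fun _ => rfl⟩

theorem isSigmaOneOneComplete_illFounded : IsSigmaOneOneComplete illFounded := by
  refine ⟨analyticSet_illFounded, fun X _ _ hX B hB => ?_⟩
  obtain ⟨j, hjc, hji⟩ := exists_continuous_injective_nat_bool hX
  obtain ⟨T, hT⟩ := exists_treeProjection_eq (hB.image_of_continuous hjc)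
  refine ⟨fun x l => T.boolIndicator (res (j x) l.length, l), continuous_pi fun l => ?_, ?_⟩
  · exact (((isLocallyConstant_res l.length).comp_continuous hjc).comp
      fun s => T.boolIndicator (s, l)).continuous
  · have hpre : j ⁻¹' treeProjection T = B := by rw [hT, preimage_image_eq B hji]
    simpa only [illFounded, treeProjection, preimage_ofPred_eq, res_length,
      ← mem_iff_boolIndicator] using hpre

namespace IsSigmaOneOneComplete

theorem of_preimage_eq {Y Z : Type*} [TopologicalSpace Y] [TopologicalSpace Z] {S : Set Y}
    {S' : Set Z} (hS : IsSigmaOneOneComplete S) (hS' : AnalyticSet S') {q : Y → Z}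
    (hq : Continuous q) (hqS : q ⁻¹' S' = S) : IsSigmaOneOneComplete S' := by
  refine ⟨hS', fun X _ _ hX B hB => ?_⟩
  obtain ⟨r, hr, rfl⟩ := hS.2 X hX B hB
  exact ⟨q ∘ r, hq.comp hr, by rw [preimage_comp, hqS]⟩

theorem not_measurableSet {Y : Type*} [TopologicalSpace Y] {S : Set Y}
    (hS : IsSigmaOneOneComplete S) : ¬ MeasurableSet[borel Y] S := by
  intro hSm
  obtain ⟨D, hDa, hDm⟩ := exists_analyticSet_not_measurableSet
  obtain ⟨r, hr, rfl⟩ := hS.2 (ℕ → Bool) isTopologicalBasis_isClopen D hDa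
  exact hDm (hr.borel_measurable hSm)

end IsSigmaOneOneComplete

lemma isClosed_setOf_isBackwardOrbit {X : Type*} [TopologicalSpace X] [T2Space X] {f : X → X}
    (hf : Continuous f) (x : X) : IsClosed {u : ℕ → X | IsBackwardOrbit f x u} := by
  simp only [IsBackwardOrbit, ofPred_and, ofPred_forall]
  exact (isClosed_eq (continuous_apply 0) continuous_const).inter (isClosed_iInter fun n =>
    isClosed_eq (hf.comp (continuous_apply (n + 1))) (continuous_apply n))

lemma isGδ_setOf_mapClusterPt {X : Type*} [PseudoMetricSpace X] :
    IsGδ {p : (ℕ → X) × X | MapClusterPt p.2 atTop p.1} := by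
  have hInter : {p : (ℕ → X) × X | MapClusterPt p.2 atTop p.1} =
      ⋂ k : ℕ, ⋂ N : ℕ, ⋃ n ≥ N, {p | dist (p.1 n) p.2 < 1 / ((k : ℝ) + 1)} := by
    ext p
    simp only [mem_ofPred_eq, mem_iInter, mem_iUnion, exists_prop, true_imp_iff, Metric.mem_ball,
      Metric.nhds_basis_ball_inv_nat_succ.mapClusterPt_iff_frequently, frequently_atTop]
  rw [hInter]
  refine .iInter fun k => .iInter_of_isOpen fun N => isOpen_biUnion fun n _ => ?_
  exact isOpen_lt (((continuous_apply n).comp continuous_fst).dist continuous_snd) continuous_const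

theorem analyticSet_specialAlphaLimit {X : Type*} [TopologicalSpace X] [PolishSpace X]
    {f : X → X} (hf : Continuous f) (x : X) : AnalyticSet (specialAlphaLimit f x) := by
  let := TopologicalSpace.upgradeIsCompletelyMetrizable X
  borelize ((ℕ → X) × X)
  have horbit := (isClosed_setOf_isBackwardOrbit hf x).preimage
    (continuous_fst : Continuous (Prod.fst : (ℕ → X) × X → ℕ → X))
  convert (horbit.measurableSet.inter isGδ_setOf_mapClusterPt.measurableSet).analyticSet
    |>.image_of_continuous continuous_snd
  ext y
  simp [specialAlphaLimit]

lemma tendsto_extend_zero_cofinite {ι X : Type*} {x : ι → X} (hx : Function.Injective x)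
    {τ : ι → ℝ} (hτ : Tendsto τ cofinite (𝓝 0)) :
    Tendsto (Function.extend x τ 0) cofinite (𝓝 0) := by
  refine fun U hU => ((mem_cofinite.1 (hτ hU)).image x).subset fun p hp => ?_
  by_cases hpx : ∃ i, x i = p
  · obtain ⟨i, rfl⟩ := hpx
    exact mem_image_of_mem x (by simpa [hx.extend_apply] using hp)
  · simp only [mem_compl_iff, mem_preimage, Function.extend_apply' _ _ _ hpx] at hp
    exact (hp (mem_of_mem_nhds hU)).elim

lemma continuousOn_extend_zero {ι X : Type*} [TopologicalSpace X] [T1Space X] {x : ι → X}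
    (hx : Function.Injective x) (hdisc : ∀ i, ¬ AccPt (x i) (𝓟 (range x))) {τ : ι → ℝ}
    (hτ : Tendsto τ cofinite (𝓝 0)) :
    ContinuousOn (Function.extend x τ 0) (closure (range x)) := by
  intro p _
  by_cases hp : p ∈ range x
  · obtain ⟨i, rfl⟩ := hp
    refine continuousWithinAt_sdiff_self.1 (continuousWithinAt_of_notMem_closure ?_)
    have hcl : ¬ AccPt (x i) (𝓟 (closure (range x))) := fun h =>
      hdisc i (by rwa [← mem_derivedSet, ← derivedSet_closure])
    rwa [accPt_principal_iff_clusterPt, ← mem_closure_iff_clusterPt] at hcl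
  · refine (continuousAt_iff_punctured_nhds.2 ?_).continuousWithinAt
    rw [Function.extend_apply' _ _ _ hp]
    exact (tendsto_extend_zero_cofinite hx hτ).mono_left (nhdsNE_le_cofinite p)

theorem exists_continuousMap_eq_of_tendsto_cofinite {ι X : Type*} [TopologicalSpace X]
    [NormalSpace X] [T1Space X] {x : ι → X} (hx : Function.Injective x)
    (hdisc : ∀ i, ¬ AccPt (x i) (𝓟 (range x))) {τ : ι → ℝ} (hτ : Tendsto τ cofinite (𝓝 0)) :
    ∃ t : C(X, ℝ), ∀ i, t (x i) = τ i := by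
  obtain ⟨t, ht⟩ := ContinuousMap.exists_restrict_eq isClosed_closure
    ⟨_, continuousOn_iff_continuous_domRestrict.1 (continuousOn_extend_zero hx hdisc hτ)⟩
  refine ⟨t, fun i => ?_⟩
  simpa [hx.extend_apply] using
    DFunLike.congr_fun ht ⟨x i, subset_closure (mem_range_self i)⟩

/-- The piecewise linear base map: each of the laps `[0, 1/5]`, `[1/5, 2/5]`, `[2/5, 3/5]` is
stretched onto `[0, 4/5]`, and `[3/5, 1]` is mapped onto `[4/5, 1]`. -/
noncomputable def zigzag (x : unitInterval) : unitInterval :=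
  ⟨max (min (4 * x) (8 / 5 - 4 * x)) (min (4 * x - 8 / 5) ((x + 1) / 2)), by
    have hx₀ := x.2.1
    have hx₁ := x.2.2
    rw [mem_Icc, le_max_iff, le_min_iff, le_min_iff, max_le_iff, min_le_iff, min_le_iff]
    grind⟩

section Zigzag

variable {x : unitInterval}

lemma coe_zigzag (x : unitInterval) :
    (zigzag x : ℝ) =
      max (min (4 * (x : ℝ)) (8 / 5 - 4 * x)) (min (4 * (x : ℝ) - 8 / 5) ((x + 1) / 2)) :=
  rfl

lemma coe_zigzag_of_le (h : (x : ℝ) ≤ 1 / 5) : (zigzag x : ℝ) = 4 * x := by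
  rw [coe_zigzag, min_eq_left (by linarith), max_eq_left (min_le_of_left_le (by linarith))]

lemma coe_zigzag_of_mem_Icc (h : (x : ℝ) ∈ Icc (1 / 5 : ℝ) (2 / 5)) :
    (zigzag x : ℝ) = 8 / 5 - 4 * x := by
  obtain ⟨h₁, h₂⟩ := h
  rw [coe_zigzag, min_eq_right (by linarith), max_eq_left (min_le_of_left_le (by linarith))]

lemma coe_zigzag_of_ge (h : 2 / 5 ≤ (x : ℝ)) :
    (zigzag x : ℝ) = min (4 * (x : ℝ) - 8 / 5) ((x + 1) / 2) := by
  rw [coe_zigzag, max_eq_right]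
  exact min_le_of_right_le (le_min (by linarith) (by linarith))

lemma four_fifths_le_zigzag (h : 3 / 5 ≤ (x : ℝ)) : 4 / 5 ≤ (zigzag x : ℝ) := by
  rw [coe_zigzag_of_ge (by linarith)]
  exact le_min (by linarith) (by linarith)

lemma four_fifths_le_iterate_zigzag (h : 4 / 5 ≤ (x : ℝ)) (n : ℕ) :
    4 / 5 ≤ (zigzag^[n] x : ℝ) := by
  induction n generalizing x with
  | zero => exact h
  | succ _ ih => exact ih (four_fifths_le_zigzag (by linarith))

lemma continuous_zigzag : Continuous zigzag := by
  unfold zigzag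
  fun_prop

lemma surjective_zigzag : Function.Surjective zigzag := by
  have h₀ : zigzag 0 = 0 := by norm_num [zigzag]
  have h₁ : zigzag 1 = 1 := by norm_num [zigzag]
  intro y
  have hy : y ∈ Icc (zigzag 0) (zigzag 1) := h₀.symm ▸ h₁.symm ▸ ⟨y.2.1, y.2.2⟩
  obtain ⟨x, -, hx⟩ := intermediate_value_Icc zero_le_one continuous_zigzag.continuousOn hy
  exact ⟨x, hx⟩

lemma isPiecewiseMonotone_zigzag : IsPiecewiseMonotone zigzag := by
  refine ⟨3, ![0, ⟨1 / 5, by norm_num, by norm_num⟩, ⟨2 / 5, by norm_num, by norm_num⟩, 1],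
    Fin.strictMono_iff_lt_succ.2 fun i => ?_, rfl, rfl, fun i => ?_⟩
  · rw [← Subtype.coe_lt_coe]
    fin_cases i <;> simp <;> norm_num
  fin_cases i
  · refine Or.inl fun x hx y hy hxy => Subtype.coe_lt_coe.1 ?_
    rw [coe_zigzag_of_le hx.2, coe_zigzag_of_le hy.2]
    linarith [Subtype.coe_lt_coe.2 hxy]
  · refine Or.inr fun x hx y hy hxy => Subtype.coe_lt_coe.1 ?_
    rw [coe_zigzag_of_mem_Icc hx, coe_zigzag_of_mem_Icc hy]
    linarith [Subtype.coe_lt_coe.2 hxy]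
  · refine Or.inl fun x hx y hy hxy => Subtype.coe_lt_coe.1 ?_
    rw [coe_zigzag_of_ge hx.1, coe_zigzag_of_ge hy.1]
    have hxy' := Subtype.coe_lt_coe.2 hxy
    exact min_lt_min (by linarith) (by linarith)

end Zigzag

/-- The inverse over `[0, 4/5]` of the `i`-th lap of `zigzag`. -/
noncomputable def lapInverse (i : Fin 3) (z : unitInterval) : unitInterval :=
  ⟨![(z : ℝ) / 4, 2 / 5 - (z : ℝ) / 4, 2 / 5 + (z : ℝ) / 4] i, by
    have hz₀ := z.2.1
    have hz₁ := z.2.2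
    fin_cases i <;> simp <;> constructor <;> linarith⟩

section LapInverse

variable {z w : unitInterval}

lemma coe_lapInverse_zero : (lapInverse 0 z : ℝ) = z / 4 := rfl

lemma coe_lapInverse_one : (lapInverse 1 z : ℝ) = 2 / 5 - z / 4 := rfl

lemma coe_lapInverse_two : (lapInverse 2 z : ℝ) = 2 / 5 + z / 4 := rfl

lemma coe_lapInverse_mem_Ioo (hz : (z : ℝ) ∈ Ioo (0 : ℝ) (4 / 5)) (i : Fin 3) :
    (lapInverse i z : ℝ) ∈ Ioo (0 : ℝ) (3 / 5) := by
  obtain ⟨hz₀, hz₁⟩ := hz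
  fin_cases i <;>
    simp only [Fin.zero_eta, Fin.mk_one, Fin.reduceFinMk, coe_lapInverse_zero, coe_lapInverse_one,
      coe_lapInverse_two] <;> constructor <;> linarith

lemma zigzag_lapInverse (hz : (z : ℝ) ∈ Ioo (0 : ℝ) (4 / 5)) (i : Fin 3) :
    zigzag (lapInverse i z) = z := by
  obtain ⟨hz₀, hz₁⟩ := hz
  refine Subtype.ext ?_
  fin_cases i <;> simp only [Fin.zero_eta, Fin.mk_one, Fin.reduceFinMk]
  · have h := coe_lapInverse_zero (z := z)
    rw [coe_zigzag_of_le (by linarith)]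
    linarith
  · have h := coe_lapInverse_one (z := z)
    rw [coe_zigzag_of_mem_Icc ⟨by linarith, by linarith⟩]
    linarith
  · have h := coe_lapInverse_two (z := z)
    rw [coe_zigzag_of_ge (by linarith), min_eq_left (by linarith)]
    linarith

lemma exists_lapInverse_zigzag_eq {x : unitInterval} (h : (zigzag x : ℝ) < 4 / 5) :
    ∃ i, lapInverse i (zigzag x) = x := by
  rcases le_total (x : ℝ) (1 / 5) with h₁ | h₁
  · refine ⟨0, Subtype.ext ?_⟩
    rw [coe_lapInverse_zero, coe_zigzag_of_le h₁]
    ring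
  rcases le_total (x : ℝ) (2 / 5) with h₂ | h₂
  · refine ⟨1, Subtype.ext ?_⟩
    rw [coe_lapInverse_one, coe_zigzag_of_mem_Icc ⟨h₁, h₂⟩]
    ring
  · have h₃ : (x : ℝ) < 3 / 5 := by
      by_contra! h₃
      exact h.not_ge (four_fifths_le_zigzag h₃)
    refine ⟨2, Subtype.ext ?_⟩
    rw [coe_lapInverse_two, coe_zigzag_of_ge h₂, min_eq_left (by linarith)]
    ring

lemma lapInverse_inj (hz : (z : ℝ) ∈ Ioo (0 : ℝ) (4 / 5)) (hw : (w : ℝ) ∈ Ioo (0 : ℝ) (4 / 5))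
    {i j : Fin 3} (h : lapInverse i z = lapInverse j w) : i = j ∧ z = w := by
  have hzw : z = w := by rw [← zigzag_lapInverse hz i, h, zigzag_lapInverse hw j]
  subst hzw
  refine ⟨?_, rfl⟩
  obtain ⟨hz₀, hz₁⟩ := hz
  have h' : (lapInverse i z : ℝ) = lapInverse j z := congrArg Subtype.val h
  fin_cases i <;> fin_cases j <;>
    simp only [Fin.zero_eta, Fin.mk_one, Fin.reduceFinMk, coe_lapInverse_zero, coe_lapInverse_one,
      coe_lapInverse_two] at h' ⊢ <;> exfalso <;> linarith

end LapInverse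

/-- The points of the backward tree of `7/10` under `zigzag`, labelled by the words of the lap
inverses that produce them; the one applied last comes first. The root lies in the image of the
three laps but not in their union. -/
noncomputable def treePoint : List (Fin 3) → unitInterval
  | [] => ⟨7 / 10, by norm_num, by norm_num⟩
  | i :: s => lapInverse i (treePoint s)

lemma coe_treePoint_nil : (treePoint [] : ℝ) = 7 / 10 := rfl

lemma coe_treePoint_mem_Ioo (s : List (Fin 3)) : (treePoint s : ℝ) ∈ Ioo (0 : ℝ) (4 / 5) := by
  induction s with
  | nil => norm_num [coe_treePoint_nil]
  | cons i s ih => exact Ioo_subset_Ioo_right (by norm_num) (coe_lapInverse_mem_Ioo ih i)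

lemma coe_treePoint_cons_lt (i : Fin 3) (s : List (Fin 3)) : (treePoint (i :: s) : ℝ) < 3 / 5 :=
  (coe_lapInverse_mem_Ioo (coe_treePoint_mem_Ioo s) i).2

lemma treePoint_cons_ne_nil (i : Fin 3) (s : List (Fin 3)) : treePoint (i :: s) ≠ treePoint [] := by
  intro h
  have hlt := coe_treePoint_cons_lt i s
  rw [h, coe_treePoint_nil] at hlt
  norm_num at hlt

lemma treePoint_injective : Function.Injective treePoint := by
  intro s
  induction s with
  | nil =>
    rintro (_ | ⟨j, t⟩) h
    · rfl
    · exact (treePoint_cons_ne_nil j t h.symm).elim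
  | cons i s ih =>
    rintro (_ | ⟨j, t⟩) h
    · exact (treePoint_cons_ne_nil i s h).elim
    · obtain ⟨rfl, hst⟩ := lapInverse_inj (coe_treePoint_mem_Ioo s) (coe_treePoint_mem_Ioo t) h
      rw [ih hst]

lemma zigzag_treePoint_cons (i : Fin 3) (s : List (Fin 3)) :
    zigzag (treePoint (i :: s)) = treePoint s :=
  zigzag_lapInverse (coe_treePoint_mem_Ioo s) i

lemma exists_treePoint_cons_eq {x : unitInterval} {s : List (Fin 3)}
    (h : zigzag x = treePoint s) : ∃ i, treePoint (i :: s) = x := by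
  obtain ⟨i, hi⟩ := exists_lapInverse_zigzag_eq (h ▸ (coe_treePoint_mem_Ioo s).2)
  exact ⟨i, by rwa [h] at hi⟩

lemma iterate_length_zigzag_treePoint (s : List (Fin 3)) :
    zigzag^[s.length] (treePoint s) = treePoint [] := by
  induction s with
  | nil => rfl
  | cons i s ih => rw [List.length_cons, Function.iterate_succ_apply, zigzag_treePoint_cons, ih]

lemma length_eq_of_iterate_zigzag_treePoint_mem_Ioo {s : List (Fin 3)} {n : ℕ}
    (h : (zigzag^[n] (treePoint s) : ℝ) ∈ Ioo (3 / 5 : ℝ) (4 / 5)) : s.length = n := by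
  induction s generalizing n with
  | nil =>
    cases n with
    | zero => rfl
    | succ n =>
      refine (h.2.not_ge (four_fifths_le_iterate_zigzag (four_fifths_le_zigzag ?_) n)).elim
      norm_num [coe_treePoint_nil]
  | cons i s ih =>
    cases n with
    | zero => exact (h.1.not_gt (coe_treePoint_cons_lt i s)).elim
    | succ n =>
      rw [Function.iterate_succ_apply, zigzag_treePoint_cons] at h
      rw [List.length_cons, ih h]

lemma not_accPt_range_treePoint (s : List (Fin 3)) :
    ¬ AccPt (treePoint s) (𝓟 (range treePoint)) := by
  intro hacc
  let V : Set unitInterval := {x | (zigzag^[s.length] x : ℝ) ∈ Ioo (3 / 5 : ℝ) (4 / 5)}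
  have hV : V ∈ 𝓝 (treePoint s) := by
    refine (isOpen_Ioo.preimage (continuous_subtype_val.comp
      (continuous_zigzag.iterate s.length))).mem_nhds ?_
    rw [mem_preimage, Function.comp_apply, iterate_length_zigzag_treePoint]
    norm_num [coe_treePoint_nil]
  refine Set.Infinite.of_accPt (hacc.nhds_inter hV) ?_
  refine ((List.finite_length_eq (Fin 3) s.length).image treePoint).subset ?_
  rintro _ ⟨hxV, t, rfl⟩
  exact mem_image_of_mem _ (length_eq_of_iterate_zigzag_treePoint_mem_Ioo hxV)

lemma coe_treePoint_res_add {w : ℕ → Fin 3} {n : ℕ} (k : ℕ) (hw : ∀ i < k, w (n + i) = 0) :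
    (treePoint (res w (n + k)) : ℝ) = treePoint (res w n) / 4 ^ k := by
  induction k with
  | zero => simp
  | succ k ih =>
    have ih' := ih fun i hi => hw i (hi.trans k.lt_succ_self)
    rw [← add_assoc, res_succ, hw k k.lt_succ_self, treePoint, coe_lapInverse_zero, ih', pow_succ,
      div_div]

/-- The average of `v` over the suffixes of a word, the word itself and the empty word included. -/
noncomputable def suffixAverage {α : Type*} (v : List α → ℝ) (s : List α) : ℝ :=
  (s.tails.map v).sum / (s.length + 1)

section SuffixAverage

variable {α : Type*} {v : List α → ℝ}

lemma suffixAverage_cons_sub (i : α) (s : List α) :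
    suffixAverage v (i :: s) - suffixAverage v s =
      (v (i :: s) - suffixAverage v s) / (s.length + 2) := by
  simp only [suffixAverage, List.tails_cons, List.map_cons, List.sum_cons, List.length_cons,
    Nat.cast_succ]
  field_simp
  ring

lemma abs_suffixAverage_le {C : ℝ} (hv : ∀ s, |v s| ≤ C) (s : List α) :
    |suffixAverage v s| ≤ C := by
  have hsum : |(s.tails.map v).sum| ≤ (s.length + 1) * C := by
    induction s with
    | nil => simpa using hv []
    | cons i s ih =>
      rw [List.tails_cons, List.map_cons, List.sum_cons, List.length_cons, Nat.cast_succ, add_mul,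
        one_mul, add_comm]
      exact (abs_add_le _ _).trans (add_le_add ih (hv _))
  have hpos : (0 : ℝ) < s.length + 1 := by positivity
  rwa [suffixAverage, abs_div, abs_of_pos hpos, div_le_iff₀' hpos]

lemma tendsto_suffixAverage_tail_sub [Finite α] {C : ℝ} (hv : ∀ s, |v s| ≤ C) :
    Tendsto (fun s => suffixAverage v s.tail - suffixAverage v s) cofinite (𝓝 0) := by
  have hle (s : List α) : |suffixAverage v s.tail - suffixAverage v s| ≤ 2 * C / s.length := by
    rcases s with _ | ⟨i, s⟩
    · simp
    rw [List.tail_cons, abs_sub_comm, suffixAverage_cons_sub, abs_div, List.length_cons,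
      Nat.cast_succ, abs_of_pos (by positivity : (0 : ℝ) < s.length + 2), two_mul]
    have hC := (abs_sub _ _).trans (add_le_add (hv (i :: s)) (abs_suffixAverage_le hv s))
    gcongr
    · exact (abs_nonneg _).trans hC
    · norm_num
  have hlength : Tendsto (fun s : List α => (s.length : ℝ)) cofinite atTop :=
    tendsto_natCast_atTop_atTop.comp (tendsto_atTop.2 fun n => by
      simpa [Filter.eventually_cofinite] using List.finite_length_lt α n)
  exact squeeze_zero_norm hle (hlength.const_div_atTop _)

lemma sum_map_tails_res (v : List α → ℝ) (w : ℕ → α) (n : ℕ) :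
    ((res w n).tails.map v).sum = ∑ k ∈ Finset.range (n + 1), v (res w k) := by
  induction n with
  | zero => simp
  | succ n ih =>
    rw [Finset.sum_range_succ, ← ih, res_succ, List.tails_cons, List.map_cons, List.sum_cons,
      add_comm]

lemma tendsto_suffixAverage_res {w : ℕ → α} {c : ℝ}
    (h : Tendsto (fun n => v (res w n)) atTop (𝓝 c)) :
    Tendsto (fun n => suffixAverage v (res w n)) atTop (𝓝 c) := by
  refine (h.cesaro.comp (tendsto_add_atTop_nat 1)).congr fun n => ?_
  rw [Function.comp_apply, suffixAverage, sum_map_tails_res, res_length, Nat.cast_succ,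
    inv_mul_eq_div]

end SuffixAverage

/-- The letters of a word, listed from its end (so from the first one that `PiNat.res` has
prepended) and continued by zeros. -/
def padZero {α : Type*} [Zero α] (s : List α) (m : ℕ) : α := s.reverse.getD m 0

/-- The lengths of the runs of zeros between consecutive nonzero terms of `w`, with `k` subtracted
from the length of the `k`-th run, so that every code is attained by a sequence with arbitrarily
long runs of zeros. The junk values for shorter runs, or for finitely many nonzero terms, only
repeat values attained by such sequences. -/
noncomputable def runCode {α : Type*} [Zero α] (w : ℕ → α) (k : ℕ) : ℕ :=
  Nat.nth (w · ≠ 0) (k + 1) - (Nat.nth (w · ≠ 0) k + 1 + k)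

section RunCode

variable {α : Type*} [Zero α]

lemma padZero_res_ne_zero_iff {w : ℕ → α} {n m : ℕ} :
    padZero (res w n) m ≠ 0 ↔ m < n ∧ w m ≠ 0 := by
  have hreverse : (res w n).reverse = (List.range n).map w := by
    induction n with
    | zero => rfl
    | succ n ih => rw [res_succ, List.reverse_cons, ih, List.range_succ, List.map_append,
        List.map_singleton]
  rw [padZero, hreverse]
  by_cases hm : m < n <;> simp [hm]

lemma eventually_nth_lt_and_eq (p : ℕ → Prop) (k : ℕ) :
    ∀ᶠ n in atTop, Nat.nth (fun m => m < n ∧ p m) k = Nat.nth p k := by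
  classical
  by_cases hk : ∀ hf : (Set.ofPred p).Finite, k < hf.toFinset.card
  · filter_upwards [eventually_gt_atTop (Nat.nth p k)] with n hn
    have hcount : Nat.count (fun m => m < n ∧ p m) (Nat.nth p k) = k := by
      refine Eq.trans ?_ (Nat.count_nth hk)
      rw [Nat.count_eq_card_filter_range, Nat.count_eq_card_filter_range]
      refine congrArg Finset.card (Finset.filter_congr fun m hm => ?_)
      exact and_iff_right ((Finset.mem_range.1 hm).trans hn)
    have hnth := Nat.nth_count (p := fun m => m < n ∧ p m) ⟨hn, Nat.nth_mem k hk⟩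
    rwa [hcount] at hnth
  · push Not at hk
    obtain ⟨hf, hk⟩ := hk
    refine Eventually.of_forall fun n => ?_
    have hsub : Set.ofPred (fun m => m < n ∧ p m) ⊆ Set.ofPred p := fun m hm => hm.2
    rw [Nat.nth_of_card_le hf hk, Nat.nth_of_card_le (hf.subset hsub)]
    exact (Finset.card_le_card (Set.Finite.toFinset_mono hsub)).trans hk

lemma tendsto_runCode_padZero_res (w : ℕ → α) :
    Tendsto (fun n => runCode (padZero (res w n))) atTop (𝓝 (runCode w)) := by
  refine tendsto_pi_nhds.2 fun k => tendsto_const_nhds.congr' ?_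
  filter_upwards [eventually_nth_lt_and_eq (w · ≠ 0) k,
    eventually_nth_lt_and_eq (w · ≠ 0) (k + 1)] with n hk hk'
  simp only [runCode, padZero_res_ne_zero_iff, hk, hk']

lemma nth_mem_range {p : ℕ → ℕ} (hp : StrictMono p) : Nat.nth (· ∈ range p) = p := by
  have hinf : (Set.ofPred (· ∈ range p)).Infinite := infinite_range_of_injective hp.injective
  exact ((Nat.nth_strictMono hinf).range_inj hp).1 (Nat.range_nth_of_infinite hinf)

theorem exists_runCode_eq [Nontrivial α] (b : ℕ → ℕ) :
    ∃ w : ℕ → α, runCode w = b ∧ ∀ k, ∃ n, ∀ i < k, w (n + i) = 0 := by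
  classical
  obtain ⟨c, hc⟩ := exists_ne (0 : α)
  let p (k : ℕ) : ℕ := ∑ j ∈ Finset.range k, (b j + 1 + j)
  have hp_succ (k : ℕ) : p (k + 1) = p k + (b k + 1 + k) := Finset.sum_range_succ _ _
  have hp : StrictMono p := strictMono_nat_of_lt_succ fun k => by have := hp_succ k; omega
  let w (m : ℕ) : α := if m ∈ range p then c else 0
  have hw {m : ℕ} : w m ≠ 0 ↔ m ∈ range p := by simp [w, hc]
  have hnth : Nat.nth (w · ≠ 0) = p := by simpa only [hw] using nth_mem_range hp
  refine ⟨w, funext fun k => ?_, fun k => ⟨p k + 1, fun i hi => ?_⟩⟩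
  · rw [runCode, hnth, hp_succ]
    omega
  · refine not_not.1 (mt hw.1 ?_)
    rintro ⟨j, hj⟩
    have hkj : k < j := hp.lt_iff_lt.1 (by omega)
    have hjk : j < k + 1 := hp.lt_iff_lt.1 (by rw [hp_succ]; omega)
    omega

end RunCode

/-- The homeomorphisms `y ↦ y ^ exp t` of the unit interval, a flow with time parameter `t`. -/
noncomputable def powFlow (t : ℝ) (y : unitInterval) : unitInterval :=
  ⟨(y : ℝ) ^ Real.exp t, Real.rpow_nonneg y.2.1 _,
    Real.rpow_le_one y.2.1 y.2.2 (Real.exp_pos t).le⟩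

lemma continuous_powFlow : Continuous fun p : ℝ × unitInterval => powFlow p.1 p.2 :=
  Continuous.subtype_mk ((continuous_subtype_val.comp continuous_snd).rpow
    (Real.continuous_exp.comp continuous_fst) fun _ => Or.inr (Real.exp_pos _)) _

lemma strictMono_powFlow (t : ℝ) : StrictMono (powFlow t) := fun y _ h =>
  Real.rpow_lt_rpow y.2.1 h (Real.exp_pos t)

lemma powFlow_powFlow_neg (t : ℝ) (y : unitInterval) : powFlow t (powFlow (-t) y) = y :=
  Subtype.ext (by simp [powFlow, ← Real.rpow_mul y.2.1, ← Real.exp_add])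

/-- The orbit of `exp (-1)` under `powFlow`, parametrized by time; it identifies the line with the
interior of the unit interval, and the flow with the translations. -/
noncomputable def expNegExp (a : ℝ) : unitInterval :=
  ⟨Real.exp (-Real.exp a), (Real.exp_pos _).le,
    Real.exp_le_one_iff.2 (neg_nonpos.2 (Real.exp_pos a).le)⟩

lemma continuous_expNegExp : Continuous expNegExp := by
  unfold expNegExp
  fun_prop

lemma expNegExp_injective : Function.Injective expNegExp := fun _ _ h =>
  Real.exp_injective (neg_injective (Real.exp_injective (congrArg Subtype.val h)))

lemma powFlow_expNegExp (t a : ℝ) : powFlow t (expNegExp a) = expNegExp (a + t) :=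
  Subtype.ext (by simp [powFlow, expNegExp, ← Real.exp_mul, Real.exp_add])

lemma mapClusterPt_prodMk_iff_of_tendsto {ι X Y : Type*} [TopologicalSpace X]
    [TopologicalSpace Y] [T2Space Y] {l : Filter ι} {u : ι → X} {v : ι → Y} {x : X} {y c : Y}
    (hv : Tendsto v l (𝓝 c)) :
    MapClusterPt (x, y) l (fun i => (u i, v i)) ↔ MapClusterPt x l u ∧ y = c := by
  simp only [mapClusterPt_iff_ultrafilter]
  constructor
  · rintro ⟨U, hU, hxy⟩
    obtain ⟨hx, hy⟩ := (Prod.tendsto_iff _ _).1 hxy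
    exact ⟨⟨U, hU, hx⟩, tendsto_nhds_unique hy (hv.mono_left hU)⟩
  · rintro ⟨⟨U, hU, hx⟩, rfl⟩
    exact ⟨U, hU, hx.prodMk_nhds (hv.mono_left hU)⟩

lemma isBackwardOrbit_iff_exists_res {X α : Type*} [Nonempty α] {f : X → X} {P : List α → X}
    (hP : ∀ s, f ⁻¹' {P s} = range fun i => P (i :: s)) {u : ℕ → X} :
    IsBackwardOrbit f (P []) u ↔ ∃ w : ℕ → α, ∀ n, u n = P (res w n) := by
  constructor
  · rintro ⟨hu₀, hu⟩
    have hpreimage (x : X) (s : List α) : f x = P s → ∃ i, P (i :: s) = x := fun hx =>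
      (hP s).subset hx
    choose! letter hletter using hpreimage
    let word : ℕ → List α := fun n => Nat.rec [] (fun k s => letter (u (k + 1)) s :: s) n
    let w : ℕ → α := fun n => letter (u (n + 1)) (word n)
    have hres (n : ℕ) : res w n = word n := by
      induction n with
      | zero => rfl
      | succ n ih => rw [res_succ, ih]
    refine ⟨w, fun n => ?_⟩
    induction n with
    | zero => exact hu₀
    | succ n ih =>
      rw [hres] at ih ⊢
      exact (hletter _ _ ((hu n).trans ih)).symm
  · rintro ⟨w, hw⟩
    refine ⟨hw 0, fun n => ?_⟩
    rw [hw, hw]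
    exact (hP (res w n)).symm.subset (mem_range_self (w n))

lemma mapClusterPt_zero_treePoint_res {w : ℕ → Fin 3} (hw : ∀ k, ∃ n, ∀ i < k, w (n + i) = 0) :
    MapClusterPt 0 atTop fun n => treePoint (res w n) := by
  choose n hn using hw
  have htop : Tendsto (fun k => n k + k) atTop atTop :=
    tendsto_atTop_mono (fun k => Nat.le_add_left k (n k)) tendsto_id
  refine MapClusterPt.of_comp htop (tendsto_subtype_rng.2 ?_).mapClusterPt
  refine squeeze_zero (fun k => (coe_treePoint_mem_Ioo _).1.le) (fun k => ?_)
    (tendsto_pow_atTop_nhds_zero_of_lt_one (r := (1 / 4 : ℝ)) (by norm_num) (by norm_num))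
  rw [Function.comp_apply, coe_treePoint_res_add k (hn k), div_pow, one_pow]
  have hlt := (coe_treePoint_mem_Ioo (res w (n k))).2
  gcongr
  linarith

/-- The skew product over `zigzag` whose fibre map over `x` is the time `t x` map of `powFlow`. -/
noncomputable def skewZigzag (t : C(unitInterval, ℝ)) (p : UnitSquare) : UnitSquare :=
  (zigzag p.1, powFlow (t p.1) p.2)

section SkewZigzag

variable (t : C(unitInterval, ℝ))

lemma continuous_skewZigzag : Continuous (skewZigzag t) :=
  (continuous_zigzag.comp continuous_fst).prodMk
    (continuous_powFlow.comp ((t.continuous.comp continuous_fst).prodMk continuous_snd))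

lemma surjective_skewZigzag : Function.Surjective (skewZigzag t) := by
  rintro ⟨x, y⟩
  obtain ⟨x', rfl⟩ := surjective_zigzag x
  exact ⟨(x', powFlow (-t x') y), Prod.ext rfl (powFlow_powFlow_neg _ _)⟩

lemma isPiecewiseMonotoneTriangular_skewZigzag : IsPiecewiseMonotoneTriangular (skewZigzag t) :=
  ⟨zigzag, fun x => powFlow (t x), fun _ _ => rfl, isPiecewiseMonotone_zigzag,
    fun _ => strictMono_powFlow _⟩

end SkewZigzag

/-- The point over `treePoint s` at the height with parameter `a s`. -/
noncomputable def liftedTreePoint (a : List (Fin 3) → ℝ) (s : List (Fin 3)) : UnitSquare :=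
  (treePoint s, expNegExp (a s))

section LiftedTreePoint

variable {t : C(unitInterval, ℝ)} {a : List (Fin 3) → ℝ}

lemma skewZigzag_liftedTreePoint_cons (ht : ∀ s, t (treePoint s) = a s.tail - a s) (i : Fin 3)
    (s : List (Fin 3)) : skewZigzag t (liftedTreePoint a (i :: s)) = liftedTreePoint a s := by
  refine Prod.ext (zigzag_treePoint_cons i s) ?_
  simp only [skewZigzag, liftedTreePoint, ht, powFlow_expNegExp, List.tail_cons,
    add_sub_cancel]

lemma preimage_skewZigzag_liftedTreePoint (ht : ∀ s, t (treePoint s) = a s.tail - a s)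
    (s : List (Fin 3)) :
    skewZigzag t ⁻¹' {liftedTreePoint a s} = range fun i => liftedTreePoint a (i :: s) := by
  refine Subset.antisymm ?_ (range_subset_iff.2 fun i => skewZigzag_liftedTreePoint_cons ht i s)
  rintro ⟨x, y⟩ hxy
  obtain ⟨i, rfl⟩ := exists_treePoint_cons_eq (congrArg Prod.fst hxy)
  refine ⟨i, Prod.ext rfl ((strictMono_powFlow (t (treePoint (i :: s)))).injective ?_)⟩
  exact congrArg Prod.snd ((skewZigzag_liftedTreePoint_cons ht i s).trans hxy.symm)

lemma mem_specialAlphaLimit_skewZigzag_iff (ht : ∀ s, t (treePoint s) = a s.tail - a s)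
    {p : UnitSquare} :
    p ∈ specialAlphaLimit (skewZigzag t) (liftedTreePoint a []) ↔
      ∃ w : ℕ → Fin 3, MapClusterPt p atTop fun n => liftedTreePoint a (res w n) := by
  simp only [specialAlphaLimit, mem_ofPred_eq,
    isBackwardOrbit_iff_exists_res (preimage_skewZigzag_liftedTreePoint ht)]
  constructor
  · rintro ⟨u, ⟨w, hw⟩, hp⟩
    exact ⟨w, funext hw ▸ hp⟩
  · rintro ⟨w, hp⟩
    exact ⟨_, ⟨w, fun _ => rfl⟩, hp⟩

end LiftedTreePoint

theorem exists_specialAlphaLimit_skewZigzag_eq {φ : (ℕ → ℕ) → ℝ} (hφ : Continuous φ)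
    {C : ℝ} (hC : ∀ b, |φ b| ≤ C) :
    ∃ (t : C(unitInterval, ℝ)) (x₀ : UnitSquare),
      Prod.mk 0 ⁻¹' specialAlphaLimit (skewZigzag t) x₀ = expNegExp '' range φ := by
  let a : List (Fin 3) → ℝ := suffixAverage fun s => φ (runCode (padZero s))
  obtain ⟨t, ht⟩ := exists_continuousMap_eq_of_tendsto_cofinite treePoint_injective
    not_accPt_range_treePoint (tendsto_suffixAverage_tail_sub fun s => hC (runCode (padZero s)))
  refine ⟨t, liftedTreePoint a [], ?_⟩
  have hlim (w : ℕ → Fin 3) :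
      Tendsto (fun n => expNegExp (a (res w n))) atTop (𝓝 (expNegExp (φ (runCode w)))) :=
    (continuous_expNegExp.tendsto _).comp
      (tendsto_suffixAverage_res ((hφ.tendsto _).comp (tendsto_runCode_padZero_res w)))
  ext y
  rw [mem_preimage, mem_specialAlphaLimit_skewZigzag_iff ht]
  constructor
  · rintro ⟨w, hw⟩
    obtain ⟨-, rfl⟩ := (mapClusterPt_prodMk_iff_of_tendsto (hlim w)).1 hw
    exact mem_image_of_mem _ (mem_range_self _)
  · rintro ⟨_, ⟨b, rfl⟩, rfl⟩
    obtain ⟨w, rfl, hw⟩ := exists_runCode_eq (α := Fin 3) b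
    exact ⟨w, (mapClusterPt_prodMk_iff_of_tendsto (hlim w)).2
      ⟨mapClusterPt_zero_treePoint_res hw, rfl⟩⟩

theorem exists_isSigmaOneOneComplete_specialAlphaLimit_skewZigzag :
    ∃ (t : C(unitInterval, ℝ)) (x₀ : UnitSquare),
      IsSigmaOneOneComplete (specialAlphaLimit (skewZigzag t) x₀) := by
  obtain ⟨e, hec, hei⟩ := exists_continuous_injective_real
    (isTopologicalBasis_isClopen (X := List ℕ → Bool))
  obtain ⟨C, hC⟩ := (isCompact_univ.image hec).isBounded.exists_norm_le
  have hanalytic := analyticSet_illFounded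
  rw [AnalyticSet] at hanalytic
  obtain ⟨φ, hφ, hφrange⟩ := hanalytic.resolve_left illFounded_nonempty.ne_empty
  obtain ⟨t, x₀, hfibre⟩ := exists_specialAlphaLimit_skewZigzag_eq (hec.comp hφ)
    fun b => hC _ (mem_image_of_mem e (mem_univ (φ b)))
  refine ⟨t, x₀, isSigmaOneOneComplete_illFounded.of_preimage_eq
    (analyticSet_specialAlphaLimit (continuous_skewZigzag t) x₀)
    (q := fun T => (0, expNegExp (e T)))
    (continuous_const.prodMk (continuous_expNegExp.comp hec)) ?_⟩
  calc (fun T => ((0 : unitInterval), expNegExp (e T))) ⁻¹' specialAlphaLimit (skewZigzag t) x₀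
    _ = (expNegExp ∘ e) ⁻¹' (expNegExp '' range (e ∘ φ)) := by rw [← hfibre]; rfl
    _ = illFounded := by
      rw [range_comp, ← image_comp, preimage_image_eq _ (expNegExp_injective.comp hei), hφrange]

theorem theorem4p1 :
    ∃ (F : UnitSquare → UnitSquare) (x₀ : UnitSquare),
      Continuous F ∧ Function.Surjective F ∧ IsPiecewiseMonotoneTriangular F ∧
        IsSigmaOneOneComplete (specialAlphaLimit F x₀) ∧
        ¬ @MeasurableSet UnitSquare (borel UnitSquare) (specialAlphaLimit F x₀) := by
  obtain ⟨t, x₀, hcomplete⟩ := exists_isSigmaOneOneComplete_specialAlphaLimit_skewZigzag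
  exact ⟨skewZigzag t, x₀, continuous_skewZigzag t, surjective_skewZigzag t,
    isPiecewiseMonotoneTriangular_skewZigzag t, hcomplete, hcomplete.not_measurableSet⟩
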